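/- Let $G$ be a locally compact group and let $X$ be a non-empty minimal $G$-flow, i.e. a non-empty compact Hausdorff space with a (jointly) continuous action of $G$ all of whose orbits are dense. An irreducible extension of $X$ is a continuous $G$-equivariant surjection $\rho\colon Y\to X$ from a $G$-flow $Y$ (a compact Hausdorff space with a continuous $G$-action) such that every non-empty open subset of $Y$ contains $\rho^{-1}(\{x\})$ for some $x\in X$. The universal irreducible extension of $X$ is an irreducible extension $\pi\colon\hat X_G\to X$ such that for every irreducible extension $\rho\colon Y\to X$ there is a continuous $G$-equivariant map $p\colon\hat X_G\to Y$ with $\rho\circ p=\pi$. Let $\mathrm{Sub}(G)$ be the space of closed subgroups of $G$ with the Chabauty topology, which is generated by the sets $\{H : H\cap K=\emptyset\}$ ($K\subseteq G$ compact) and $\{H : H\cap U\neq\emptyset\}$ ($U\subseteq G$ open), on which $G$ acts by conjugation, and for a point $z$ of a $G$-flow let $G_z=\{g\in G : g\cdot z=z\}$. Then the universal irreducible extension $\hat X_G$ exists, the closure in $\mathrm{Sub}(G)$ of $\{G_x : x\in X\}$ contains a unique minimal non-empty closed conjugation-invariant subset (the stabilizer URS of $X$), and for every universal irreducible extension $\hat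 X_G$ of $X$ this subset is equal to the stabilizer flow $$S_G(X)=\{G_z : z\in \hat X_G\}.$$ -/

import Mathlib

open Set

universe u v

/-- A `G`-map: a continuous `G`-equivariant map between `G`-spaces. -/
structure IsGMap (G : Type v) [Group G] {Y X : Type u} [TopologicalSpace Y] [TopologicalSpace X]
    [MulAction G Y] [MulAction G X] (π : Y → X) : Prop where
  continuous : Continuous π
  map_smul : ∀ (g : G) (y : Y), π (g • y) = g • π y

/-- An irreducible extension of `G`-flows: a surjective `G`-map such that every non-empty open
subset of the source contains the whole fibre over some point of the target. -/
structure IsIrreducibleExtension (G : Type v) [Group G] {Y X : Type u} [TopologicalSpace Y]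
    [TopologicalSpace X] [MulAction G Y] [MulAction G X] (π : Y → X) : Prop
    extends IsGMap G π where
  surjective : Function.Surjective π
  exists_fiber_subset : ∀ U : Set Y, IsOpen U → U.Nonempty → ∃ x : X, π ⁻¹' {x} ⊆ U

/-- `π : Z → X` is the universal irreducible extension of the `G`-flow `X`: it is an irreducible
extension, and it factors through every irreducible extension `ρ : Y → X` by a `G`-flow `Y`
(a compact Hausdorff space with a jointly continuous action). -/
structure IsUniversalIrreducibleExtension (G : Type v) [Group G] [TopologicalSpace G]
    {Z X : Type u} [TopologicalSpace Z] [TopologicalSpace X] [MulAction G Z] [MulAction G X]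
    (π : Z → X) : Prop extends IsIrreducibleExtension G π where
  exists_lift : ∀ (Y : Type u) [TopologicalSpace Y] [CompactSpace Y] [T2Space Y] [MulAction G Y]
    [ContinuousSMul G Y] (ρ : Y → X), IsIrreducibleExtension G ρ →
      ∃ p : Z → Y, IsGMap G p ∧ ρ ∘ p = π

/-- The Chabauty topology on the space `Sub(G)` of closed subgroups of `G`: it is generated by
the sets `{H | H ∩ K = ∅}`, `K` compact, and `{H | H ∩ U ≠ ∅}`, `U` open. -/
instance chabautyTopology (G : Type v) [Group G] [TopologicalSpace G] :
    TopologicalSpace (ClosedSubgroup G) :=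
  TopologicalSpace.generateFrom
    ({S | ∃ K : Set G, IsCompact K ∧ S = {H : ClosedSubgroup G | (H : Set G) ∩ K = ∅}} ∪
     {S | ∃ U : Set G, IsOpen U ∧ S = {H : ClosedSubgroup G | ((H : Set G) ∩ U).Nonempty}})

/-- The conjugate `g H g⁻¹` of a closed subgroup `H`. -/
def conjClosedSubgroup {G : Type v} [Group G] [TopologicalSpace G] [IsTopologicalGroup G]
    (g : G) (H : ClosedSubgroup G) : ClosedSubgroup G where
  toSubgroup := H.toSubgroup.map (MulAut.conj g).toMonoidHom
  isClosed' := by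
    have h : IsClosed ((fun x : G => g⁻¹ * x * g) ⁻¹' (H : Set G)) :=
      H.isClosed'.preimage (by fun_prop)
    convert h using 1
    ext x
    constructor
    · rintro ⟨y, hy, rfl⟩
      have hy' : y ∈ H := hy
      simpa [mul_assoc] using hy'
    · intro hx
      exact ⟨g⁻¹ * x * g, hx, by simp [mul_assoc]⟩

/-- The stabilizer map `x ↦ G_x` of a `G`-flow, with values in `Sub(G)`. -/
def stabMap (G : Type v) [Group G] [TopologicalSpace G] (X : Type u) [TopologicalSpace X]
    [T2Space X] [MulAction G X] [ContinuousSMul G X] (x : X) : ClosedSubgroup G where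
  toSubgroup := MulAction.stabilizer G x
  isClosed' := by
    have h : IsClosed ((fun g : G => g • x) ⁻¹' {x}) :=
      isClosed_singleton.preimage (by fun_prop)
    exact h

/-- A (non-empty) subflow of `Sub(G)`: a non-empty closed subset invariant under conjugation. -/
structure IsSubflow {G : Type v} [Group G] [TopologicalSpace G] [IsTopologicalGroup G]
    (M : Set (ClosedSubgroup G)) : Prop where
  nonempty : M.Nonempty
  isClosed : IsClosed M
  conj_mem : ∀ (g : G), ∀ H ∈ M, conjClosedSubgroup g H ∈ M

/-- A uniformly recurrent subgroup: a minimal subflow of `Sub(G)`. -/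
def IsURS {G : Type v} [Group G] [TopologicalSpace G] [IsTopologicalGroup G]
    (M : Set (ClosedSubgroup G)) : Prop :=
  Minimal IsSubflow M

/-- `M` is the stabilizer URS of `X`: the unique minimal subflow of the closure of the set of
stabilizers of points of `X`. -/
structure IsStabilizerURS (G : Type v) [Group G] [TopologicalSpace G] [IsTopologicalGroup G]
    (X : Type u) [TopologicalSpace X] [T2Space X] [MulAction G X] [ContinuousSMul G X]
    (M : Set (ClosedSubgroup G)) : Prop where
  isURS : IsURS M
  subset : M ⊆ closure (range (stabMap G X))
  unique : ∀ N : Set (ClosedSubgroup G), IsURS N → N ⊆ closure (range (stabMap G X)) → N = M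

/-! Existence: the universal extension is a minimal subflow of the fibre product over X of all
irreducible extensions, which `injective_code` makes indexable by a type. A factor map M → Z from a
compact minimal flow is irreducible once its fibres are generically small (`fiberFilter`): finitely
many translates of an open set cover M, so a generic fibre has a translate meeting that set. Generic
smallness defines a filter, so it can be checked coordinatewise in a product.

Let Z be universal. Every irreducible extension of Z splits (`exists_section`). Applied to a minimal
flow of limits of the visiting-time sets {g | g • z ∈ closure B}, this gives a continuous choice of
limits, whence closure B ⊆ interior (closure (V • B)) for B open and V a neighbourhood of 1: Z is
maximally highly proximal. On such a flow the stabilizer map is continuous, by a pigeonhole argument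
(`notMem_closure`).

Finally let N be a subflow of the closure of the stabilizers of X, and M a minimal flow of pairs (z,
H) with H ∈ N that are limits of pairs (z, G_{π z}). As G_z ≤ G_{π z}, continuity gives G_z ≤ H;
irreducibility and minimality give H ≤ G_z. Since M maps onto Z, every G_z lies in N. So the
stabilizers of Z form the least subflow of that closure, which yields both minimality and
uniqueness. -/

open Filter Topology Pointwise

/-! ### Irreducible maps: rigidity, size and splitting -/

/-- A continuous surjection is irreducible if every non-empty open subset of the source contains
a whole fibre. -/
structure IsIrreducibleMap {Y X : Type*} [TopologicalSpace Y] [TopologicalSpace X]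
    (π : Y → X) : Prop where
  continuous : Continuous π
  surjective : Function.Surjective π
  exists_fiber_subset : ∀ U : Set Y, IsOpen U → U.Nonempty → ∃ x : X, π ⁻¹' {x} ⊆ U

theorem isOpen_setOf_fiber_subset {Y X : Type*} [TopologicalSpace Y] [TopologicalSpace X]
    [CompactSpace Y] [T2Space X] {π : Y → X} (hπ : Continuous π) {U : Set Y} (hU : IsOpen U) :
    IsOpen {x : X | π ⁻¹' {x} ⊆ U} := by
  have h : IsClosed (π '' Uᶜ) := hπ.isClosedMap _ hU.isClosed_compl
  convert h.isOpen_compl using 1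
  ext x
  simp only [mem_ofPred_eq, mem_compl_iff, mem_image, not_exists, not_and]
  constructor
  · rintro h y hy rfl
    exact hy (h rfl)
  · intro h y hy
    by_contra hyU
    exact h y hyU hy

namespace IsIrreducibleMap

section

variable {Y X : Type*} [TopologicalSpace Y] [TopologicalSpace X] {π : Y → X}

/-- The set of fibres contained in one of the two members of an open cover is dense. -/
theorem dense_union_setOf_fiber_subset (h : IsIrreducibleMap π) {A B : Set Y} (hA : IsOpen A)
    (hB : IsOpen B) (hAB : A ∪ B = univ) :
    Dense ({x : X | π ⁻¹' {x} ⊆ A} ∪ {x : X | π ⁻¹' {x} ⊆ B}) := by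
  rw [dense_iff_inter_open]
  rintro O hO ⟨x, hx⟩
  obtain ⟨y, rfl⟩ := h.surjective x
  have key : ∀ C : Set Y, IsOpen C → y ∈ C → ∃ x' ∈ O, π ⁻¹' {x'} ⊆ C := by
    intro C hC hy
    obtain ⟨x', hx'⟩ := h.exists_fiber_subset (C ∩ π ⁻¹' O) (hC.inter (hO.preimage h.continuous))
      ⟨y, hy, hx⟩
    obtain ⟨y', rfl⟩ := h.surjective x'
    exact ⟨_, (hx' rfl).2, fun z hz => (hx' hz).1⟩
  rcases (hAB ▸ mem_univ y : y ∈ A ∪ B) with hy | hy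
  · obtain ⟨x', hx', hs⟩ := key A hA hy
    exact ⟨x', hx', Or.inl hs⟩
  · obtain ⟨x', hx', hs⟩ := key B hB hy
    exact ⟨x', hx', Or.inr hs⟩

theorem comp {W : Type*} [TopologicalSpace W] [CompactSpace W] [T2Space Y] {q : W → Y}
    (h : IsIrreducibleMap π) (hq : IsIrreducibleMap q) : IsIrreducibleMap (π ∘ q) where
  continuous := h.continuous.comp hq.continuous
  surjective := h.surjective.comp hq.surjective
  exists_fiber_subset U hU hne := by
    obtain ⟨x, hx⟩ := h.exists_fiber_subset _ (isOpen_setOf_fiber_subset hq.continuous hU)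
      (hq.exists_fiber_subset U hU hne)
    exact ⟨x, fun w hw => hx (show q w ∈ π ⁻¹' {x} from hw) rfl⟩

theorem comp_homeomorph {W : Type*} [TopologicalSpace W] (h : IsIrreducibleMap π) (e : W ≃ₜ Y) :
    IsIrreducibleMap (π ∘ e) where
  continuous := h.continuous.comp e.continuous
  surjective := h.surjective.comp e.surjective
  exists_fiber_subset U hU hne := by
    obtain ⟨x, hx⟩ := h.exists_fiber_subset (e.symm ⁻¹' U) (hU.preimage e.symm.continuous)
      (by obtain ⟨w, hw⟩ := hne; exact ⟨e w, by simpa using hw⟩)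
    exact ⟨x, fun w hw => by simpa using hx (show e w ∈ π ⁻¹' {x} from hw)⟩

/-- A continuous self-map of an irreducible extension over the base is the identity. -/
theorem eq_of_comp_eq [T2Space Y] (h : IsIrreducibleMap π) {f : Y → Y} (hf : Continuous f)
    (hπf : ∀ y, π (f y) = π y) (y : Y) : f y = y := by
  by_contra hne
  obtain ⟨U, V, hU, hV, hyU, hyV, hd⟩ := t2_separation hne
  obtain ⟨x, hx⟩ := h.exists_fiber_subset (V ∩ f ⁻¹' U) (hV.inter (hU.preimage hf)) ⟨y, hyV, hyU⟩
  obtain ⟨z, rfl⟩ := h.surjective x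
  exact hd.le_bot ⟨(hx rfl).2, (hx (hπf z)).1⟩

/-- A point of an irreducible extension is determined by the subsets of the base whose preimages
accumulate at it. -/
theorem injective_code [CompactSpace Y] [T2Space Y] [T2Space X] (h : IsIrreducibleMap π) :
    Function.Injective fun y : Y => {O : Set X | y ∈ closure (π ⁻¹' O)} := by
  intro y y' hyy
  by_contra hne
  obtain ⟨U, V, hU, hV, hyU, hyV, hd⟩ := t2_separation hne
  -- The separating set is the union of the fibres contained in `U`: these accumulate at `y`, but
  -- `V` keeps them away from `y'`.
  have h1 : y ∈ closure (π ⁻¹' {x : X | π ⁻¹' {x} ⊆ U}) := by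
    rw [mem_closure_iff]
    intro A hA hy
    obtain ⟨x, hx⟩ := h.exists_fiber_subset (A ∩ U) (hA.inter hU) ⟨y, hy, hyU⟩
    obtain ⟨z, rfl⟩ := h.surjective x
    exact ⟨z, (hx rfl).1, fun w hw => (hx hw).2⟩
  have h2 : y' ∈ closure (π ⁻¹' {x : X | π ⁻¹' {x} ⊆ U}) := by
    have hcode : {O : Set X | y ∈ closure (π ⁻¹' O)} = {O : Set X | y' ∈ closure (π ⁻¹' O)} := hyy
    exact hcode.subset h1
  obtain ⟨z, hzV, hz⟩ := mem_closure_iff.1 h2 V hV hyV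
  exact hd.le_bot ⟨hz rfl, hzV⟩

end

/-- The source of an irreducible extension which is minimal is minimal. -/
theorem isMinimal {G Y X : Type*} [Group G] [TopologicalSpace Y] [TopologicalSpace X]
    [CompactSpace Y] [T2Space X] [MulAction G Y] [MulAction G X] [MulAction.IsMinimal G X]
    {π : Y → X} (h : IsIrreducibleMap π) (hG : ∀ (g : G) y, π (g • y) = g • π y) :
    MulAction.IsMinimal G Y where
  dense_orbit y := by
    rw [dense_iff_inter_open]
    intro U hU hne
    obtain ⟨g, hg⟩ := (isOpen_setOf_fiber_subset h.continuous hU).exists_smul_mem G (π y)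
      (h.exists_fiber_subset U hU hne)
    exact ⟨g • y, hg (hG g y), g, rfl⟩

/-- Every irreducible extension of `X` has a copy on a subset of `Set (Set X)`. -/
theorem exists_model {G : Type v} {X : Type u} {Y : Type*} [Group G] [TopologicalSpace G]
    [TopologicalSpace X] [T2Space X] [TopologicalSpace Y] [CompactSpace Y] [T2Space Y]
    [MulAction G Y] [ContinuousSMul G Y] {π : Y → X} (h : IsIrreducibleMap π) :
    ∃ (s : Set (Set (Set X))) (_ : TopologicalSpace s) (_ : MulAction G s)
      (_ : ContinuousSMul G s) (e : s ≃ₜ Y), ∀ (g : G) (y : s), e (g • y) = g • e y := by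
  let e : Y ≃ range (fun y : Y => {O : Set X | y ∈ closure (π ⁻¹' O)}) :=
    Equiv.ofInjective _ h.injective_code
  let t : TopologicalSpace (range (fun y : Y => {O : Set X | y ∈ closure (π ⁻¹' O)})) :=
    TopologicalSpace.induced e.symm inferInstance
  let a : MulAction G (range (fun y : Y => {O : Set X | y ∈ closure (π ⁻¹' O)})) :=
    e.symm.mulAction G
  have hG : ∀ (g : G) y, e.symm (g • y) = g • e.symm y := fun g y => e.symm_apply_apply _
  let e' := e.symm.toHomeomorphOfIsInducing ⟨rfl⟩
  refine ⟨_, t, a, ⟨?_⟩, e', hG⟩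
  have : (fun p : G × range (fun y : Y => {O : Set X | y ∈ closure (π ⁻¹' O)}) => p.1 • p.2) =
      fun p => e'.symm (p.1 • e' p.2) := rfl
  rw [this]
  exact e'.symm.continuous.comp (continuous_fst.smul (e'.continuous.comp continuous_snd))

end IsIrreducibleMap

theorem IsIrreducibleExtension.isIrreducibleMap {G : Type v} [Group G] {Y X : Type u}
    [TopologicalSpace Y] [TopologicalSpace X] [MulAction G Y] [MulAction G X] {π : Y → X}
    (h : IsIrreducibleExtension G π) : IsIrreducibleMap π :=
  ⟨h.continuous, h.surjective, h.exists_fiber_subset⟩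

theorem IsIrreducibleMap.isIrreducibleExtension {G : Type v} [Group G] {Y X : Type u}
    [TopologicalSpace Y] [TopologicalSpace X] [MulAction G Y] [MulAction G X] {π : Y → X}
    (h : IsIrreducibleMap π) (hG : ∀ (g : G) y, π (g • y) = g • π y) :
    IsIrreducibleExtension G π :=
  ⟨⟨h.continuous, hG⟩, h.surjective, h.exists_fiber_subset⟩

/-- Every irreducible extension of a universal irreducible extension splits. -/
theorem IsUniversalIrreducibleExtension.exists_section {G : Type v} [Group G] [TopologicalSpace G]
    {Z X : Type u} [TopologicalSpace Z] [TopologicalSpace X] [T2Space Z] [T2Space X]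
    [MulAction G Z] [MulAction G X] {π : Z → X} (h : IsUniversalIrreducibleExtension G π)
    {M : Type*} [TopologicalSpace M] [CompactSpace M] [T2Space M] [MulAction G M]
    [ContinuousSMul G M] {q : M → Z} (hq : IsIrreducibleMap q)
    (hG : ∀ (g : G) m, q (g • m) = g • q m) :
    ∃ s : Z → M, Continuous s ∧ ∀ z, q (s z) = z := by
  have hπ := h.toIsIrreducibleExtension.isIrreducibleMap
  have hρ := hπ.comp hq
  -- `M` may live in another universe, so the lifting property is applied to its copy over `X`. The
  -- lift followed by the map to `Z` is a self-map of `Z` over `X`, hence the identity.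
  obtain ⟨Y, _, _, _, e, he⟩ := hρ.exists_model (G := G)
  have : CompactSpace Y := e.symm.compactSpace
  have : T2Space Y := e.symm.t2Space
  have hρe := hρ.comp_homeomorph e
  obtain ⟨p, hp, hpπ⟩ := h.exists_lift Y ((π ∘ q) ∘ e) (hρe.isIrreducibleExtension fun g y => by
    simp [he, hG, h.map_smul])
  refine ⟨e ∘ p, e.continuous.comp hp.continuous, ?_⟩
  exact hπ.eq_of_comp_eq (f := q ∘ e ∘ p) (hq.continuous.comp (e.continuous.comp hp.continuous))
    fun z => congrFun hpπ z

/-! ### Minimal subflows and generically small fibres -/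

/-- A closed non-empty invariant set contains a minimal flow. -/
theorem exists_isMinimal_subMulAction {G P : Type*} [Group G] [TopologicalSpace P]
    [CompactSpace P] [MulAction G P] [ContinuousConstSMul G P] {W : Set P} (hW : IsClosed W)
    (hne : W.Nonempty) (hinv : ∀ (g : G), ∀ x ∈ W, g • x ∈ W) :
    ∃ M : SubMulAction G P, (M : Set P) ⊆ W ∧ IsClosed (M : Set P) ∧ (M : Set P).Nonempty ∧
      MulAction.IsMinimal G M := by
  obtain ⟨M, hMW, hM⟩ := zorn_superset_nonempty
    {A : Set P | IsClosed A ∧ A.Nonempty ∧ ∀ (g : G), ∀ x ∈ A, g • x ∈ A} (by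
      intro c hc hch hcne
      refine ⟨⋂₀ c, ⟨isClosed_sInter fun A hA => (hc hA).1, ?_, ?_⟩, fun s hs => sInter_subset_of_mem hs⟩
      · have := hcne.to_subtype
        exact IsCompact.nonempty_sInter_of_directed_nonempty_isCompact_isClosed
          (fun A hA B hB => (hch.total hA hB).elim
            (fun h => ⟨A, hA, subset_rfl, h⟩) fun h => ⟨B, hB, h, subset_rfl⟩) (fun A hA => (hc hA).2.1) (fun A hA => (hc hA).1.isCompact)
          (fun A hA => (hc hA).1)
      · exact fun g x hx A hA => (hc hA).2.2 g x (hx A hA)) W ⟨hW, hne, hinv⟩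
  have hmin : ∀ A : Set P, IsClosed A → A.Nonempty → (∀ (g : G), ∀ x ∈ A, g • x ∈ A) →
      A ⊆ M → A = M := fun A h1 h2 h3 h4 => h4.antisymm (hM.2 ⟨h1, h2, h3⟩ h4)
  refine ⟨⟨M, fun g {x} hx => hM.1.2.2 g x hx⟩, hMW, hM.1.1, hM.1.2.1, ⟨fun x => ?_⟩⟩
  have hA := hmin (closure (MulAction.orbit G (x : P))) isClosed_closure
    ⟨x, subset_closure (MulAction.mem_orbit_self _)⟩
    (fun g y hy => by
      have h : MapsTo (fun y : P => g • y) (MulAction.orbit G (x : P)) (MulAction.orbit G (x : P)) :=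
        fun z hz => (MulAction.mem_orbit_of_mem_orbit g hz)
      exact h.closure (continuous_const_smul g) hy)
    (closure_minimal (by rintro _ ⟨g, rfl⟩; exact hM.1.2.2 g _ x.2) hM.1.1)
  rw [Topology.IsInducing.subtypeVal.dense_iff]
  intro y
  have hy : (y : P) ∈ closure (MulAction.orbit G (x : P)) := hA.superset y.2
  refine closure_mono ?_ hy
  rintro _ ⟨g, rfl⟩
  exact ⟨g • x, ⟨g, rfl⟩, rfl⟩

/-- The sets `U` for which there is a neighbourhood `U'` of `m` such that generically a fibre of `q`
which meets `U'` is contained in `U`. -/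
def fiberFilter {M Z : Type*} [TopologicalSpace M] [TopologicalSpace Z] (q : M → Z) (m : M) :
    Filter M where
  sets := {U | ∃ U' ∈ 𝓝 m, ∃ D : Set Z, IsOpen D ∧ Dense D ∧
    ∀ z ∈ D, q ⁻¹' {z} ⊆ U ∨ q ⁻¹' {z} ∩ U' = ∅}
  univ_sets := ⟨univ, univ_mem, univ, isOpen_univ, dense_univ, fun _ _ => Or.inl (subset_univ _)⟩
  sets_of_superset := by
    rintro U V ⟨U', hU', D, hD, hDd, h⟩ hUV
    exact ⟨U', hU', D, hD, hDd, fun z hz => (h z hz).imp_left fun h => h.trans hUV⟩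
  inter_sets := by
    rintro U V ⟨U', hU', D, hD, hDd, h⟩ ⟨V', hV', E, hE, hEd, k⟩
    refine ⟨U' ∩ V', inter_mem hU' hV', D ∩ E, hD.inter hE, hDd.inter_of_isOpen_left hEd hD, ?_⟩
    rintro z ⟨hz, hz'⟩
    rcases h z hz with h | h
    · rcases k z hz' with k | k
      · exact Or.inl (subset_inter h k)
      · exact Or.inr (subset_empty_iff.1 fun x hx => k.subset ⟨hx.1, hx.2.2⟩)
    · exact Or.inr (subset_empty_iff.1 fun x hx => h.subset ⟨hx.1, hx.2.1⟩)

theorem mem_fiberFilter {M Z : Type*} [TopologicalSpace M] [TopologicalSpace Z] {q : M → Z} {m : M}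
    {U : Set M} : U ∈ fiberFilter q m ↔ ∃ U' ∈ 𝓝 m, ∃ D : Set Z, IsOpen D ∧ Dense D ∧
    ∀ z ∈ D, q ⁻¹' {z} ⊆ U ∨ q ⁻¹' {z} ∩ U' = ∅ := Iff.rfl

theorem tendsto_fiberFilter {M Z : Type*} [TopologicalSpace M] [TopologicalSpace Z] {q : M → Z}
    (hq : Continuous q) (m : M) : Tendsto q (fiberFilter q m) (𝓝 (q m)) := by
  intro O hO
  refine ⟨q ⁻¹' O, hq.continuousAt hO, univ, isOpen_univ, dense_univ, fun z _ => ?_⟩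
  by_cases hz : z ∈ O
  · exact Or.inl fun x hx => by rw [mem_preimage, mem_singleton_iff.1 hx]; exact hz
  · refine Or.inr (subset_empty_iff.1 fun x hx => hz ?_)
    rw [← mem_singleton_iff.1 hx.1]
    exact hx.2

/-- For a closed neighbourhood U' inside the interior of U, the latter and the complement of U'
cover `Y`. By irreducibility a dense open set of fibres of `π` lies in one of the two, and fibres of
`q` are carried into those of `π`. -/
theorem IsIrreducibleMap.tendsto_fiberFilter {M Y Z : Type*} [TopologicalSpace M]
    [TopologicalSpace Y] [CompactSpace Y] [T2Space Y] [TopologicalSpace Z] [T2Space Z] {q : M → Z}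
    {π : Y → Z} (hπ : IsIrreducibleMap π) {c : M → Y} (hc : Continuous c)
    (hπc : ∀ m, π (c m) = q m) (m : M) : Tendsto c (fiberFilter q m) (𝓝 (c m)) := by
  intro U hU
  obtain ⟨U', hU', hcl, hUU⟩ := exists_mem_nhds_isClosed_subset (interior_mem_nhds.2 hU)
  refine ⟨c ⁻¹' U', hc.continuousAt hU', {x | π ⁻¹' {x} ⊆ interior U} ∪ {x | π ⁻¹' {x} ⊆ U'ᶜ},
    (isOpen_setOf_fiber_subset hπ.continuous isOpen_interior).union
      (isOpen_setOf_fiber_subset hπ.continuous hcl.isOpen_compl),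
    hπ.dense_union_setOf_fiber_subset isOpen_interior hcl.isOpen_compl ?_, ?_⟩
  · rw [eq_univ_iff_forall]
    intro y
    by_cases hy : y ∈ U'
    · exact Or.inl (hUU hy)
    · exact Or.inr hy
  · rintro z (hz | hz)
    · exact Or.inl fun x hx => show c x ∈ U from interior_subset (hz ((hπc x).trans hx))
    · exact Or.inr (subset_empty_iff.1 fun x hx => hz ((hπc x).trans hx.1) hx.2)

theorem isOpen_and_dense_forall_inv_smul_mem {G Z : Type*} [Group G] [TopologicalSpace Z]
    [MulAction G Z] [ContinuousConstSMul G Z] {D : Set Z} (hD : IsOpen D) (hDd : Dense D)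
    (J : Finset G) :
    IsOpen {z | ∀ g ∈ J, g⁻¹ • z ∈ D} ∧ Dense {z | ∀ g ∈ J, g⁻¹ • z ∈ D} := by
  classical
  induction J using Finset.induction_on with
  | empty => simp
  | insert g J _ ih =>
    have : {z | ∀ g' ∈ insert g J, g'⁻¹ • z ∈ D} =
        (fun z => g⁻¹ • z) ⁻¹' D ∩ {z | ∀ g ∈ J, g⁻¹ • z ∈ D} := by
      ext z; simp
    rw [this]
    have ho : IsOpen ((fun z : Z => g⁻¹ • z) ⁻¹' D) := hD.preimage (continuous_const_smul _)
    exact ⟨ho.inter ih.1, (hDd.preimage (isOpenMap_smul g⁻¹)).inter_of_isOpen_left ih.2 ho⟩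

/-- A factor map of a minimal flow is irreducible as soon as its fibres are generically small. -/
theorem isIrreducibleMap_of_fiberFilter_le {G M Z : Type*} [Group G] [TopologicalSpace M]
    [CompactSpace M] [MulAction G M] [ContinuousConstSMul G M] [MulAction.IsMinimal G M]
    [TopologicalSpace Z] [MulAction G Z] [ContinuousConstSMul G Z] {q : M → Z}
    (hq : Continuous q) (hs : Function.Surjective q) (hG : ∀ (g : G) m, q (g • m) = g • q m)
    (h : ∀ m, fiberFilter q m ≤ 𝓝 m) : IsIrreducibleMap q where
  continuous := hq
  surjective := hs
  exists_fiber_subset U hU := by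
    rintro ⟨m, hm⟩
    obtain ⟨U', hU', D, hD, hDd, hDU⟩ := mem_fiberFilter.1 (h m (hU.mem_nhds hm))
    -- A point `z` is chosen whose translates by the inverses of `I` are all generic. One of these
    -- translates has a fibre meeting `U'`, so that fibre lies in `U`.
    obtain ⟨I, hI⟩ := isCompact_univ.exists_finite_cover_smul G (isOpen_interior (s := U'))
      ⟨m, mem_interior_iff_mem_nhds.2 hU'⟩
    have : Nonempty Z := ⟨q m⟩
    obtain ⟨z, hz⟩ := (isOpen_and_dense_forall_inv_smul_mem hD hDd I).2.nonempty
    obtain ⟨m', rfl⟩ := hs z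
    obtain ⟨g, hg, hm'⟩ := mem_iUnion₂.1 (hI (mem_univ m'))
    rw [mem_smul_set_iff_inv_smul_mem] at hm'
    refine ⟨g⁻¹ • q m', (hDU _ (hz g hg)).resolve_right fun he => ?_⟩
    exact he.subset ⟨hG _ _, interior_subset hm'⟩

theorem surjective_of_isMinimal {G M Z : Type*} [Group G] [TopologicalSpace M]
    [CompactSpace M] [Nonempty M] [MulAction G M] [TopologicalSpace Z] [T2Space Z] [MulAction G Z]
    [MulAction.IsMinimal G Z] {q : M → Z} (hq : Continuous q)
    (hG : ∀ (g : G) m, q (g • m) = g • q m) : Function.Surjective q := by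
  have h : Dense (range q) := dense_of_nonempty_smul_invariant G (range_nonempty q) (by
    rintro g _ ⟨_, ⟨m, rfl⟩, rfl⟩
    exact ⟨g • m, hG g m⟩)
  rw [← range_eq_univ, ← (isCompact_range hq).isClosed.closure_eq, h.closure_eq]

/-! ### Existence of the universal irreducible extension -/

/-- An irreducible extension of `X` realized on a subset of `Set (Set X)`. -/
structure ModelExtension (G : Type v) [Group G] [TopologicalSpace G] (X : Type u)
    [TopologicalSpace X] [MulAction G X] where
  carrier : Set (Set (Set X))
  topology : TopologicalSpace carrier
  proj : carrier → X
  exists_action : ∃ _ : MulAction G carrier, CompactSpace carrier ∧ T2Space carrier ∧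
    ContinuousSMul G carrier ∧ IsIrreducibleExtension G proj

namespace ModelExtension

variable {G : Type v} [Group G] [TopologicalSpace G] {X : Type u} [TopologicalSpace X]
  [MulAction G X] (i : ModelExtension G X)

instance : TopologicalSpace i.carrier := i.topology

/-- The action is recovered by choice: as a field it would bring the universe of `G` into
`ModelExtension G X`, and the product over all models could leave `Type u`. -/
noncomputable instance : MulAction G i.carrier := i.exists_action.choose

instance : CompactSpace i.carrier := i.exists_action.choose_spec.1

instance : T2Space i.carrier := i.exists_action.choose_spec.2.1

instance : ContinuousSMul G i.carrier := i.exists_action.choose_spec.2.2.1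

theorem isIrreducibleExtension : IsIrreducibleExtension G i.proj :=
  i.exists_action.choose_spec.2.2.2

end ModelExtension

theorem IsIrreducibleExtension.exists_modelExtension {G : Type v} [Group G] [TopologicalSpace G]
    {X Y : Type u} [TopologicalSpace X] [T2Space X] [MulAction G X] [TopologicalSpace Y]
    [CompactSpace Y] [T2Space Y] [MulAction G Y] [ContinuousSMul G Y] {ρ : Y → X}
    (hρ : IsIrreducibleExtension G ρ) :
    ∃ (i : ModelExtension G X) (e : i.carrier ≃ₜ Y), ∀ y : i.carrier, i.proj y = ρ (e y) := by
  obtain ⟨s, ts, as, hs, e, he⟩ := hρ.isIrreducibleMap.exists_model (G := G)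
  have hρe := hρ.isIrreducibleMap.comp_homeomorph e
  exact ⟨⟨s, ts, ρ ∘ e, as, e.symm.compactSpace, e.symm.t2Space, hs,
    hρe.isIrreducibleExtension fun g y => by simp [he, hρ.map_smul]⟩, e, fun _ => rfl⟩

theorem exists_isUniversalIrreducibleExtension (G : Type v) [Group G] [TopologicalSpace G]
    (X : Type u) [TopologicalSpace X] [CompactSpace X] [T2Space X] [Nonempty X] [MulAction G X]
    [ContinuousSMul G X] [MulAction.IsMinimal G X] :
    ∃ (Z : Type u) (_ : TopologicalSpace Z) (_ : CompactSpace Z) (_ : T2Space Z)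
      (_ : MulAction G Z) (_ : ContinuousSMul G Z) (π : Z → X),
        IsUniversalIrreducibleExtension G π := by
  have hcl : IsClosed {p : X × ∀ i : ModelExtension G X, i.carrier | ∀ i : ModelExtension G X, i.proj (p.2 i) = p.1} := by
    simp only [ofPred_forall]
    exact isClosed_iInter fun i => isClosed_eq
      (i.isIrreducibleExtension.continuous.comp ((continuous_apply i).comp continuous_snd))
      continuous_fst
  have hne : {p : X × ∀ i : ModelExtension G X, i.carrier |
      ∀ i : ModelExtension G X, i.proj (p.2 i) = p.1}.Nonempty := by
    obtain ⟨x⟩ := ‹Nonempty X›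
    choose f hf using fun i : ModelExtension G X => i.isIrreducibleExtension.surjective x
    exact ⟨(x, f), hf⟩
  obtain ⟨M, hMW, hMcl, hMne, hMmin⟩ := exists_isMinimal_subMulAction (G := G) hcl hne
    fun g p hp i => by
      show i.proj (g • p.2 i) = g • p.1
      rw [i.isIrreducibleExtension.map_smul, hp i]
  have : CompactSpace M := isCompact_iff_compactSpace.1 hMcl.isCompact
  have : Nonempty M := hMne.to_subtype
  have hq : Continuous fun m : M => m.1.1 := continuous_fst.comp continuous_subtype_val
  have hG : ∀ (g : G) (m : M), (g • m).1.1 = g • m.1.1 := fun _ _ => rfl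
  have hirr : IsIrreducibleMap fun m : M => m.1.1 := by
    refine isIrreducibleMap_of_fiberFilter_le hq (surjective_of_isMinimal hq hG) hG fun m => ?_
    rw [← tendsto_id', nhds_subtype_eq_comap, tendsto_comap_iff]
    refine (tendsto_fiberFilter hq m).prodMk_nhds (tendsto_pi_nhds.2 fun i => ?_)
    exact i.isIrreducibleExtension.isIrreducibleMap.tendsto_fiberFilter
      (c := fun m : M => m.1.2 i)
      ((continuous_apply i).comp (continuous_snd.comp continuous_subtype_val))
      (fun m => hMW m.2 i) m
  refine ⟨M, inferInstance, inferInstance, inferInstance, inferInstance, inferInstance,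
    fun m : M => m.1.1, hirr.isIrreducibleExtension hG, ?_⟩
  intro Y _ _ _ _ _ ρ hρ
  obtain ⟨i, e', hproj⟩ := hρ.exists_modelExtension
  -- The action on the model was chosen, so equivariance of `e'` is not given. It follows from
  -- rigidity: conjugating `g` by `e'` and cancelling it against the model's action gives a self-map
  -- over `X`.
  have he' : ∀ (g : G) (y : i.carrier), e' (g • y) = g • e' y := by
    intro g y
    have := i.isIrreducibleExtension.isIrreducibleMap.eq_of_comp_eq
      (f := fun y => e'.symm (g⁻¹ • e' (g • y)))
      (e'.symm.continuous.comp ((e'.continuous.comp (continuous_const_smul g)).const_smul g⁻¹))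
      (fun y => by
        rw [hproj, e'.apply_symm_apply, hρ.map_smul, ← hproj, i.isIrreducibleExtension.map_smul,
          inv_smul_smul]) y
    rw [← inv_smul_eq_iff, ← e'.apply_symm_apply (g⁻¹ • e' (g • y)), this]
  refine ⟨fun m => e' (m.1.2 i), ⟨e'.continuous.comp
    ((continuous_apply i).comp (continuous_snd.comp continuous_subtype_val)),
    fun g m => he' g (m.1.2 i)⟩, ?_⟩
  funext m
  exact (hproj _).symm.trans (hMW m.2 i)

/-! ### The Fell topology on closed subsets -/

/-- The space of closed subsets of `G`, with the Fell topology. -/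
def FellSpace (G : Type v) [TopologicalSpace G] : Type v := {F : Set G // IsClosed F}

namespace FellSpace

variable {G : Type v} [TopologicalSpace G]

instance : TopologicalSpace (FellSpace G) :=
  TopologicalSpace.generateFrom
    ({S | ∃ K : Set G, IsCompact K ∧ S = {F : FellSpace G | F.1 ∩ K = ∅}} ∪
     {S | ∃ U : Set G, IsOpen U ∧ S = {F : FellSpace G | (F.1 ∩ U).Nonempty}})

theorem isOpen_inter_eq_empty {K : Set G} (hK : IsCompact K) :
    IsOpen {F : FellSpace G | F.1 ∩ K = ∅} :=
  TopologicalSpace.isOpen_generateFrom_of_mem (Or.inl ⟨K, hK, rfl⟩)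

theorem isOpen_inter_nonempty {U : Set G} (hU : IsOpen U) :
    IsOpen {F : FellSpace G | (F.1 ∩ U).Nonempty} :=
  TopologicalSpace.isOpen_generateFrom_of_mem (Or.inr ⟨U, hU, rfl⟩)

theorem isClosed_inter_nonempty {K : Set G} (hK : IsCompact K) :
    IsClosed {F : FellSpace G | (F.1 ∩ K).Nonempty} := by
  have := (isOpen_inter_eq_empty hK).isClosed_compl
  convert this using 1
  ext F
  exact nonempty_iff_ne_empty

theorem isClosed_mem (g : G) : IsClosed {F : FellSpace G | g ∈ F.1} := by
  simpa using isClosed_inter_nonempty (isCompact_singleton (x := g))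

theorem tendsto_nhds {α : Type*} {l : Filter α} {f : α → FellSpace G} {F : FellSpace G} :
    Tendsto f l (𝓝 F) ↔
      (∀ K : Set G, IsCompact K → F.1 ∩ K = ∅ → ∀ᶠ a in l, (f a).1 ∩ K = ∅) ∧
      ∀ U : Set G, IsOpen U → (F.1 ∩ U).Nonempty → ∀ᶠ a in l, ((f a).1 ∩ U).Nonempty := by
  rw [TopologicalSpace.tendsto_nhds_generateFrom_iff]
  constructor
  · intro h
    exact ⟨fun K hK hF => h _ (Or.inl ⟨K, hK, rfl⟩) hF, fun U hU hF => h _ (Or.inr ⟨U, hU, rfl⟩) hF⟩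
  · rintro ⟨h1, h2⟩ _ (⟨K, hK, rfl⟩ | ⟨U, hU, rfl⟩) hF
    · exact h1 K hK hF
    · exact h2 U hU hF

instance : CompactSpace (FellSpace G) where
  isCompact_univ := by
    rw [isCompact_iff_ultrafilter_le_nhds]
    intro f _
    -- The limit of the ultrafilter consists of the points all of whose neighbourhoods are met by
    -- almost every set.
    let F : FellSpace G := ⟨{g | ∀ U : Set G, IsOpen U → g ∈ U → ∀ᶠ E in (f : Filter (FellSpace G)),
        (E.1 ∩ U).Nonempty}, by
      rw [← isOpen_compl_iff, isOpen_iff_forall_mem_open]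
      intro g hg
      simp only [mem_compl_iff, mem_ofPred_eq, not_forall] at hg
      obtain ⟨U, hU, hgU, h⟩ := hg
      exact ⟨U, fun x hx hx' => h (hx' U hU hx), hU, hgU⟩⟩
    refine ⟨F, mem_univ _, ?_⟩
    rw [← tendsto_id', tendsto_nhds]
    refine ⟨fun K hK hF => ?_, ?_⟩
    · have key : ∀ g ∈ K, ∃ U ∈ 𝓝[K] g, ∀ᶠ E in (f : Filter (FellSpace G)), E.1 ∩ U = ∅ := by
        intro g hg
        have hgF : g ∉ F.1 := fun h => hF.subset ⟨h, hg⟩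
        have : ∃ U : Set G, IsOpen U ∧ g ∈ U ∧ ¬ ∀ᶠ E in (f : Filter (FellSpace G)),
            (E.1 ∩ U).Nonempty := by
          by_contra! h
          exact hgF h
        obtain ⟨U, hU, hgU, h⟩ := this
        refine ⟨U, mem_nhdsWithin_of_mem_nhds (hU.mem_nhds hgU), ?_⟩
        rw [← Ultrafilter.eventually_not] at h
        exact h.mono fun E hE => not_nonempty_iff_eq_empty.1 hE
      refine hK.induction_on (p := fun S => ∀ᶠ E in (f : Filter (FellSpace G)), E.1 ∩ S = ∅)
        (by simp) ?_ ?_ key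
      · exact fun s t hst h => h.mono fun E hE => subset_empty_iff.1 fun x hx =>
          hE.subset ⟨hx.1, hst hx.2⟩
      · intro s t hs ht
        filter_upwards [hs, ht] with E h1 h2
        rw [inter_union_distrib_left, h1, h2, union_empty]
    · rintro U hU ⟨g, hg, hgU⟩
      exact hg U hU hgU

instance [LocallyCompactSpace G] : T2Space (FellSpace G) where
  t2 := by
    have key : ∀ E F : FellSpace G, ∀ g ∈ E.1, g ∉ F.1 → ∃ U V : Set (FellSpace G), IsOpen U ∧
        IsOpen V ∧ E ∈ U ∧ F ∈ V ∧ Disjoint U V := by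
      intro E F g hE hF
      obtain ⟨K, hK, hKF, hKc⟩ := local_compact_nhds (F.2.isOpen_compl.mem_nhds hF)
      refine ⟨_, _, isOpen_inter_nonempty (isOpen_interior (s := K)), isOpen_inter_eq_empty hKc,
        ⟨g, hE, mem_interior_iff_mem_nhds.2 hK⟩,
        subset_empty_iff.1 fun x hx => hKF hx.2 hx.1, ?_⟩
      rw [Set.disjoint_left]
      rintro A ⟨x, hx, hxK⟩ hA
      exact hA.subset ⟨hx, interior_subset hxK⟩
    intro E F hne
    by_cases h : E.1 ⊆ F.1
    · have h' : ¬ F.1 ⊆ E.1 := fun h' => hne (Subtype.ext (h.antisymm h'))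
      obtain ⟨g, hg, hg'⟩ := not_subset.1 h'
      obtain ⟨U, V, hU, hV, h1, h2, h3⟩ := key F E g hg hg'
      exact ⟨V, U, hV, hU, h2, h1, h3.symm⟩
    · obtain ⟨g, hg, hg'⟩ := not_subset.1 h
      exact key E F g hg hg'

section Action

variable [Group G] [IsTopologicalGroup G]

/-- `G` acts on its closed subsets by `h • F = F h⁻¹`. -/
instance : MulAction G (FellSpace G) where
  smul h F := ⟨{g | g * h ∈ F.1}, F.2.preimage (continuous_mul_const h)⟩
  one_smul F := Subtype.ext (by ext g; show g * 1 ∈ F.1 ↔ _; rw [mul_one])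
  mul_smul a b F := Subtype.ext (by
    ext g; show g * (a * b) ∈ F.1 ↔ g * a * b ∈ F.1; rw [mul_assoc])

theorem mem_smul {g h : G} {F : FellSpace G} : g ∈ (h • F).1 ↔ g * h ∈ F.1 := Iff.rfl

instance [LocallyCompactSpace G] : ContinuousSMul G (FellSpace G) where
  continuous_smul := by
    rw [continuous_iff_continuousAt]
    rintro ⟨h, F⟩
    refine tendsto_nhds.2 ⟨fun K hK hF => ?_, fun U hU => ?_⟩
    · obtain ⟨L, hL, hKL, hLF⟩ := exists_compact_between (hK.image (continuous_mul_const h))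
        F.2.isOpen_compl (by
          rintro _ ⟨g, hg, rfl⟩ hgF
          exact hF.subset ⟨hgF, hg⟩)
      have h1 : ∀ᶠ a in 𝓝 h, ∀ g ∈ K, g * a ∈ interior L :=
        hK.eventually_forall_of_forall_eventually fun g hg =>
          (isOpen_interior.preimage (continuous_snd.mul continuous_fst)).mem_nhds
            (hKL ⟨g, hg, rfl⟩)
      have h2 : ∀ᶠ E in 𝓝 F, E.1 ∩ L = ∅ := (isOpen_inter_eq_empty hL).mem_nhds
        (subset_empty_iff.1 fun x hx => hLF hx.2 hx.1)
      filter_upwards [h1.prod_nhds h2] with p hp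
      exact subset_empty_iff.1 fun g hg =>
        (show g * p.1 ∈ (∅ : Set G) from hp.2.subset ⟨hg.1, interior_subset (hp.1 g hg.2)⟩).elim
    · rintro ⟨g, hg, hgU⟩
      have hc : Continuous fun p : G × G => p.1 * p.2⁻¹ := by fun_prop
      have : (fun p : G × G => p.1 * p.2⁻¹) ⁻¹' U ∈ 𝓝 (g * h, h) :=
        (hU.preimage hc).mem_nhds (by simpa using hgU)
      rw [nhds_prod_eq] at this
      obtain ⟨A, hA, B, hB, hAB⟩ := Filter.mem_prod_iff.1 this
      have h2 : ∀ᶠ E in 𝓝 F, (E.1 ∩ interior A).Nonempty :=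
        (isOpen_inter_nonempty isOpen_interior).mem_nhds ⟨g * h, hg, mem_interior_iff_mem_nhds.2 hA⟩
      filter_upwards [(show ∀ᶠ b in 𝓝 h, b ∈ B from hB).prod_nhds h2] with p hp
      obtain ⟨x, hx, hxA⟩ := hp.2
      refine ⟨x * p.1⁻¹, ?_, hAB (mk_mem_prod (interior_subset hxA) hp.1)⟩
      show x * p.1⁻¹ * p.1 ∈ p.2.1
      simpa using hx

end Action

end FellSpace

/-! ### Closed subgroups as a closed subspace of the Fell space -/

section Chabauty

variable {G : Type v} [Group G] [TopologicalSpace G]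

/-- A closed subgroup as a closed subset. -/
def ClosedSubgroup.toFellSpace (H : ClosedSubgroup G) : FellSpace G := ⟨H, H.isClosed'⟩

theorem ClosedSubgroup.isInducing_toFellSpace :
    IsInducing (ClosedSubgroup.toFellSpace : ClosedSubgroup G → FellSpace G) := by
  refine ⟨?_⟩
  show TopologicalSpace.generateFrom _ = TopologicalSpace.induced _ (TopologicalSpace.generateFrom _)
  rw [induced_generateFrom_eq]
  congr 1
  ext S
  constructor
  · rintro (⟨K, hK, rfl⟩ | ⟨U, hU, rfl⟩)
    · exact ⟨_, Or.inl ⟨K, hK, rfl⟩, rfl⟩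
    · exact ⟨_, Or.inr ⟨U, hU, rfl⟩, rfl⟩
  · rintro ⟨_, ⟨K, hK, rfl⟩ | ⟨U, hU, rfl⟩, rfl⟩
    · exact Or.inl ⟨K, hK, rfl⟩
    · exact Or.inr ⟨U, hU, rfl⟩

theorem ClosedSubgroup.isEmbedding_toFellSpace :
    IsEmbedding (ClosedSubgroup.toFellSpace : ClosedSubgroup G → FellSpace G) :=
  ⟨isInducing_toFellSpace, fun _ _ h => SetLike.coe_injective (congrArg Subtype.val h)⟩

variable [IsTopologicalGroup G] [LocallyCompactSpace G]

theorem ClosedSubgroup.isClosed_range_toFellSpace :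
    IsClosed (range (ClosedSubgroup.toFellSpace : ClosedSubgroup G → FellSpace G)) := by
  have h1 : IsClosed {F : FellSpace G | ∀ g h, g ∈ F.1 → h ∈ F.1 → g⁻¹ * h ∈ F.1} := by
    rw [← isOpen_compl_iff, isOpen_iff_mem_nhds]
    intro F hF
    simp only [mem_compl_iff, mem_ofPred_eq, not_forall] at hF
    obtain ⟨g, h, hg, hh, hgh⟩ := hF
    obtain ⟨K, hK, hKF, hKc⟩ := local_compact_nhds (F.2.isOpen_compl.mem_nhds hgh)
    have hc : Continuous fun p : G × G => p.1⁻¹ * p.2 := by fun_prop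
    have hm : (fun p : G × G => p.1⁻¹ * p.2) ⁻¹' K ∈ 𝓝 (g, h) := hc.continuousAt hK
    rw [nhds_prod_eq] at hm
    obtain ⟨A, hA, B, hB, hAB⟩ := Filter.mem_prod_iff.1 hm
    filter_upwards [(FellSpace.isOpen_inter_eq_empty hKc).mem_nhds
        (show F.1 ∩ K = ∅ from subset_empty_iff.1 fun x hx => hKF hx.2 hx.1),
      (FellSpace.isOpen_inter_nonempty (isOpen_interior (s := A))).mem_nhds
        (show (F.1 ∩ interior A).Nonempty from ⟨g, hg, mem_interior_iff_mem_nhds.2 hA⟩),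
      (FellSpace.isOpen_inter_nonempty (isOpen_interior (s := B))).mem_nhds
        (show (F.1 ∩ interior B).Nonempty from ⟨h, hh, mem_interior_iff_mem_nhds.2 hB⟩)]
    rintro E hE ⟨a, ha, haA⟩ ⟨b, hb, hbB⟩ hE'
    exact hE.subset ⟨hE' a b ha hb, hAB (mk_mem_prod (interior_subset haA) (interior_subset hbB))⟩
  convert (FellSpace.isClosed_mem (1 : G)).inter h1 using 1
  ext F
  constructor
  · rintro ⟨H, rfl⟩
    exact ⟨one_mem H, fun g h hg hh => mul_mem (inv_mem (show g ∈ H from hg)) hh⟩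
  · rintro ⟨h1, h2⟩
    have hinv : ∀ {x}, x ∈ F.1 → x⁻¹ ∈ F.1 := fun {x} hx => by simpa using h2 x 1 hx h1
    exact ⟨⟨⟨⟨⟨F.1, fun {a b} ha hb => by simpa using h2 a⁻¹ b (hinv ha) hb⟩, h1⟩, hinv⟩, F.2⟩, rfl⟩

instance : T2Space (ClosedSubgroup G) := ClosedSubgroup.isEmbedding_toFellSpace.t2Space

instance : CompactSpace (ClosedSubgroup G) :=
  (IsClosedEmbedding.mk ClosedSubgroup.isEmbedding_toFellSpace
    ClosedSubgroup.isClosed_range_toFellSpace).compactSpace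

end Chabauty

/-! ### Visiting times and maximal high proximality -/

/-- A flow in which closures of open sets are thickened to neighbourhoods by every neighbourhood of
the identity. -/
def IsMaximallyHighlyProximal (G Z : Type*) [Group G] [TopologicalSpace G] [TopologicalSpace Z]
    [MulAction G Z] : Prop :=
  ∀ B : Set Z, IsOpen B → ∀ V ∈ 𝓝 (1 : G), closure B ⊆ interior (closure (V • B))

section Visits

variable {G Z : Type*} [Group G] [TopologicalSpace G] [TopologicalSpace Z] [MulAction G Z]
  [ContinuousSMul G Z] {C : Set Z}

/-- The set of times at which the orbit of `z` visits the closed set `C`. -/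
def visitSet (G : Type*) [Group G] [TopologicalSpace G] [MulAction G Z] [ContinuousSMul G Z]
    (hC : IsClosed C) (z : Z) : FellSpace G :=
  ⟨{g | g • z ∈ C}, hC.preimage (continuous_id.smul continuous_const)⟩

theorem mem_visitSet (hC : IsClosed C) {z : Z} {g : G} : g ∈ (visitSet G hC z).1 ↔ g • z ∈ C :=
  Iff.rfl

/-- This equivariance is the reason for letting `G` act on `FellSpace G` by right translation. -/
theorem visitSet_smul [IsTopologicalGroup G] (hC : IsClosed C) (h : G) (z : Z) :
    visitSet G hC (h • z) = h • visitSet G hC z :=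
  Subtype.ext (by ext g; rw [mem_visitSet, FellSpace.mem_smul, mem_visitSet, mul_smul])

theorem isOpen_visitSet_inter_eq_empty (hC : IsClosed C) {K : Set G} (hK : IsCompact K) :
    IsOpen {z : Z | (visitSet G hC z).1 ∩ K = ∅} := by
  rw [isOpen_iff_mem_nhds]
  intro z hz
  have : ∀ᶠ z' in 𝓝 z, ∀ g ∈ K, g • z' ∈ Cᶜ :=
    hK.eventually_forall_of_forall_eventually fun g hg =>
      (hC.isOpen_compl.preimage (continuous_snd.smul continuous_fst)).mem_nhds
        fun h => hz.subset ⟨h, hg⟩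
  exact this.mono fun z' h => subset_empty_iff.1 fun g hg => h g hg.2 hg.1

theorem subset_visitSet_of_mem_closure (hC : IsClosed C) {p : Z × FellSpace G}
    (hp : p ∈ closure (range fun z : Z => (z, visitSet G hC z))) : p.2.1 ⊆ (visitSet G hC p.1).1 := by
  intro g hg
  by_contra hgC
  have hc : Continuous fun q : Z × G => q.2 • q.1 := continuous_snd.smul continuous_fst
  have : (fun q : Z × G => q.2 • q.1) ⁻¹' Cᶜ ∈ 𝓝 (p.1, g) :=
    (hC.isOpen_compl.preimage hc).mem_nhds hgC
  obtain ⟨O, U, hO, hpO, hU, hgU, hOU⟩ := mem_nhds_prod_iff'.1 this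
  obtain ⟨_, ⟨hz, g', hg', hgU'⟩, z, rfl⟩ := mem_closure_iff.1 hp (O ×ˢ {F | (F.1 ∩ U).Nonempty})
    (hO.prod (FellSpace.isOpen_inter_nonempty hU)) ⟨hpO, g, hg, hgU⟩
  exact hOU (mk_mem_prod hz hgU') hg'

/-- Together with `subset_visitSet_of_mem_closure` this shows that, off the boundary of an open set,
the limits over a point either all miss `K` or all meet `K`. -/
theorem inter_nonempty_of_mem_closure (hC : IsClosed C) {K : Set G} (hK : IsCompact K)
    {p : Z × FellSpace G} (hp : p ∈ closure (range fun z : Z => (z, visitSet G hC z)))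
    (hz : p.1 ∈ (closure {z : Z | (visitSet G hC z).1 ∩ K = ∅})ᶜ) : (p.2.1 ∩ K).Nonempty := by
  by_contra h
  rw [not_nonempty_iff_eq_empty] at h
  obtain ⟨_, ⟨h1, h2⟩, z, rfl⟩ := mem_closure_iff.1 hp _
    (isClosed_closure.isOpen_compl.prod (FellSpace.isOpen_inter_eq_empty hK)) ⟨hz, h⟩
  exact h1 (subset_closure h2)

end Visits

/-- Visiting times in a minimal universal irreducible extension can be regularized to depend
continuously on the point. -/
theorem IsUniversalIrreducibleExtension.exists_continuous_visitSet {G : Type v} [Group G]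
    [TopologicalSpace G] [IsTopologicalGroup G] [LocallyCompactSpace G] {Z X : Type u}
    [TopologicalSpace Z] [TopologicalSpace X] [CompactSpace Z] [T2Space Z] [T2Space X] [Nonempty Z]
    [MulAction G Z] [MulAction G X] [ContinuousSMul G Z] [MulAction.IsMinimal G Z] {π : Z → X}
    (h : IsUniversalIrreducibleExtension G π) {C : Set Z} (hC : IsClosed C) :
    ∃ R : Z → FellSpace G, Continuous R ∧
      ∀ z, (z, R z) ∈ closure (range fun z : Z => (z, visitSet G hC z)) := by
  obtain ⟨M, hMW, hMcl, hMne, hMmin⟩ := exists_isMinimal_subMulAction (G := G)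
    (isClosed_closure (s := range fun z : Z => (z, visitSet G hC z)))
    (closure_nonempty_iff.2 (range_nonempty _)) (fun g p hp => by
      have hm : MapsTo (fun p : Z × FellSpace G => g • p) (range fun z : Z => (z, visitSet G hC z))
          (range fun z : Z => (z, visitSet G hC z)) := by
        rintro _ ⟨z, rfl⟩
        exact ⟨g • z, Prod.ext rfl (visitSet_smul hC g z)⟩
      exact hm.closure (continuous_const_smul g) hp)
  have : CompactSpace M := isCompact_iff_compactSpace.1 hMcl.isCompact
  have : Nonempty M := hMne.to_subtype
  have hq : Continuous fun m : M => m.1.1 := continuous_fst.comp continuous_subtype_val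
  have hG : ∀ (g : G) (m : M), (g • m).1.1 = g • m.1.1 := fun _ _ => rfl
  have hgen : ∀ K : Set G, IsCompact K → ∃ D : Set Z, IsOpen D ∧ Dense D ∧ ∀ z ∈ D,
      (∀ m : M, m.1.1 = z → m.1.2.1 ∩ K = ∅) ∨ ∀ m : M, m.1.1 = z → (m.1.2.1 ∩ K).Nonempty := by
    intro K hK
    refine ⟨{z : Z | (visitSet G hC z).1 ∩ K = ∅} ∪
      (closure {z : Z | (visitSet G hC z).1 ∩ K = ∅})ᶜ,
      (isOpen_visitSet_inter_eq_empty hC hK).union isClosed_closure.isOpen_compl, ?_, ?_⟩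
    · rw [dense_iff_closure_eq, closure_union, eq_univ_iff_forall]
      intro z
      by_cases hz : z ∈ closure {z : Z | (visitSet G hC z).1 ∩ K = ∅}
      · exact Or.inl hz
      · exact Or.inr (subset_closure hz)
    · rintro z (hz | hz)
      · refine Or.inl fun m hm => subset_empty_iff.1 fun g hg => ?_
        have := subset_visitSet_of_mem_closure hC (hMW m.2) hg.1
        rw [hm] at this
        exact hz.subset ⟨this, hg.2⟩
      · exact Or.inr fun m hm => inter_nonempty_of_mem_closure hC hK (hMW m.2) (hm ▸ hz)
  have hirr : IsIrreducibleMap fun m : M => m.1.1 := by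
    refine isIrreducibleMap_of_fiberFilter_le hq (surjective_of_isMinimal hq hG) hG fun m => ?_
    rw [← tendsto_id', nhds_subtype_eq_comap, tendsto_comap_iff]
    have hc2 : Continuous fun m : M => m.1.2 := continuous_snd.comp continuous_subtype_val
    refine (tendsto_fiberFilter hq m).prodMk_nhds (FellSpace.tendsto_nhds.2 ⟨fun K hK hF => ?_, ?_⟩)
    · obtain ⟨D, hD, hDd, hDK⟩ := hgen K hK
      refine ⟨_, ((FellSpace.isOpen_inter_eq_empty hK).preimage hc2).mem_nhds hF, D, hD, hDd,
        fun z hz => (hDK z hz).imp (fun h m hm => h m hm) fun h => ?_⟩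
      exact subset_empty_iff.1 fun m hm => (h m hm.1).ne_empty hm.2
    · rintro U hU ⟨g, hg, hgU⟩
      -- The dichotomy `hgen` concerns compact sets only, so the open set `U` is replaced by a
      -- compact neighbourhood of `g` inside it.
      obtain ⟨K, hK, hKU, hKc⟩ := local_compact_nhds (hU.mem_nhds hgU)
      obtain ⟨D, hD, hDd, hDK⟩ := hgen K hKc
      refine ⟨_, ((FellSpace.isOpen_inter_nonempty (isOpen_interior (s := K))).preimage hc2).mem_nhds
        ⟨g, hg, mem_interior_iff_mem_nhds.2 hK⟩, D, hD, hDd, fun z hz => (hDK z hz).symm.imp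
          (fun h m hm => (h m hm).mono (inter_subset_inter_right _ hKU)) fun h => ?_⟩
      refine subset_empty_iff.1 fun m hm => ?_
      obtain ⟨x, hx, hxK⟩ := hm.2
      exact (h m hm.1).subset ⟨hx, interior_subset hxK⟩
  obtain ⟨s, hs, hqs⟩ := h.exists_section hirr hG
  refine ⟨fun z => (s z).1.2, continuous_snd.comp (continuous_subtype_val.comp hs), fun z => ?_⟩
  have := hMW (s z).2
  rwa [← Prod.mk.eta (p := (s z).1), hqs z] at this

/-- For the regularized visiting times `R` of closure B, the time 1 belongs to `R z` on B, hence on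
its closure. By continuity `R` meets the inverse of V on an open set around closure B, and each
point of that set is carried into closure B by an element of the inverse of V. -/
theorem IsUniversalIrreducibleExtension.isMaximallyHighlyProximal {G : Type v} [Group G]
    [TopologicalSpace G] [IsTopologicalGroup G] [LocallyCompactSpace G] {Z X : Type u}
    [TopologicalSpace Z] [TopologicalSpace X] [CompactSpace Z] [T2Space Z] [T2Space X] [Nonempty Z]
    [MulAction G Z] [MulAction G X] [ContinuousSMul G Z] [MulAction.IsMinimal G Z] {π : Z → X}
    (h : IsUniversalIrreducibleExtension G π) : IsMaximallyHighlyProximal G Z := by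
  intro B hB V hV
  obtain ⟨R, hR, hRcl⟩ := h.exists_continuous_visitSet (isClosed_closure (s := B))
  have h1 : ∀ z ∈ B, (1 : G) ∈ (R z).1 := by
    intro z hz
    have := inter_nonempty_of_mem_closure isClosed_closure (isCompact_singleton (x := (1 : G)))
      (hRcl z) (fun hz' => by
        obtain ⟨y, hyB, hy⟩ := mem_closure_iff.1 hz' B hB hz
        exact hy.subset ⟨by rw [mem_visitSet, one_smul]; exact subset_closure hyB, rfl⟩)
    simpa using this
  have h2 : closure B ⊆ {z | (1 : G) ∈ (R z).1} :=
    closure_minimal h1 ((FellSpace.isClosed_mem 1).preimage hR)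
  have h3 : IsOpen {z | ((R z).1 ∩ interior V⁻¹).Nonempty} :=
    (FellSpace.isOpen_inter_nonempty isOpen_interior).preimage hR
  refine fun z hz => mem_interior.2 ⟨_, ?_, h3, 1, h2 hz,
    mem_interior_iff_mem_nhds.2 (inv_mem_nhds_one G hV)⟩
  rintro y ⟨g, hg, hgV⟩
  have hy : g • y ∈ closure B := subset_visitSet_of_mem_closure isClosed_closure (hRcl y) hg
  have hgV' : g⁻¹ ∈ V := Set.mem_inv.1 (interior_subset hgV)
  have hm : MapsTo (fun x : Z => g⁻¹ • x) B (V • B) := fun x hx => Set.smul_mem_smul hgV' hx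
  simpa using hm.closure (continuous_const_smul g⁻¹) hy

/-! ### Continuity of the stabilizer map -/

/-- If `g` maps a point of the closure of `B` into the closure of `C` then arbitrarily small
perturbations of `g` map a point of `B` into `C`. -/
theorem IsMaximallyHighlyProximal.exists_smul_mem {G Z : Type*} [Group G] [TopologicalSpace G]
    [IsTopologicalGroup G] [TopologicalSpace Z] [MulAction G Z] [ContinuousSMul G Z]
    (hZ : IsMaximallyHighlyProximal G Z) {B C : Set Z} (hB : IsOpen B) (hC : IsOpen C) {b : Z}
    (hb : b ∈ closure B) {g : G} (hg : g • b ∈ closure C) {V : Set G} (hV : V ∈ 𝓝 g) :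
    ∃ v ∈ V, ∃ x ∈ B, v • x ∈ C := by
  have hc : Continuous fun p : G × G => p.1⁻¹ * g * p.2 := by fun_prop
  have hm : (fun p : G × G => p.1⁻¹ * g * p.2) ⁻¹' V ∈ 𝓝 ((1 : G), (1 : G)) :=
    hc.continuousAt (by simpa using hV)
  rw [nhds_prod_eq] at hm
  obtain ⟨P, hP, Q, hQ, hPQ⟩ := Filter.mem_prod_iff.1 hm
  have h1 := hZ C hC P hP hg
  have h2 := hZ B hB Q hQ hb
  have hPC : IsOpen (P • C) := hC.smul_left
  obtain ⟨y, ⟨hy, -⟩, hyC⟩ := mem_closure_iff.1 (interior_subset h1)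
    (((fun z : Z => g⁻¹ • z) ⁻¹' interior (closure (Q • B))) ∩ univ)
    ((isOpen_interior.preimage (continuous_const_smul _)).inter isOpen_univ)
    ⟨by simpa using h2, trivial⟩
  obtain ⟨y', hy', hyB⟩ := mem_closure_iff.1 (interior_subset hy) ((fun z : Z => g • z) ⁻¹' (P • C))
    (hPC.preimage (continuous_const_smul _)) (by simpa using hyC)
  obtain ⟨q, hq, x, hx, rfl⟩ := mem_smul.1 hyB
  obtain ⟨p, hp, c, hc, hpc⟩ := mem_smul.1 hy'
  refine ⟨p⁻¹ * g * q, hPQ (mk_mem_prod hp hq), x, hx, ?_⟩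
  have hpc' : g • q • x = p • c := hpc.symm
  rw [mul_smul, mul_smul, hpc', inv_smul_smul]
  exact hc

theorem closure_smul_subset_of_isCompact {G Z : Type*} [Group G] [TopologicalSpace G]
    [IsTopologicalGroup G] [TopologicalSpace Z] [MulAction G Z] [ContinuousSMul G Z] {V : Set G}
    (hV : IsCompact V)
    (D : Set Z) : closure (V • D) ⊆ V • closure D :=
  closure_minimal (smul_subset_smul_left subset_closure)
    (isClosed_closure.smul_left_of_isCompact hV)

section

variable {G Z : Type*} [Group G] [TopologicalSpace G] [TopologicalSpace Z] [T2Space Z]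
  [MulAction G Z] [ContinuousSMul G Z]

theorem isOpen_setOf_forall_smul_ne {L : Set G} (hL : IsCompact L) :
    IsOpen {z : Z | ∀ l ∈ L, l • z ≠ z} := by
  rw [isOpen_iff_mem_nhds]
  intro z hz
  exact hL.eventually_forall_of_forall_eventually fun l hl =>
    (isOpen_ne_fun (continuous_snd.smul continuous_fst) continuous_fst).mem_nhds (hz l hl)

theorem exists_isOpen_forall_smul_notMem {L : Set G} (hL : IsCompact L) {z : Z}
    (hz : ∀ l ∈ L, l • z ≠ z) :
    ∃ O : Set Z, IsOpen O ∧ z ∈ O ∧ ∀ l ∈ L, ∀ x ∈ O, l • x ∉ O := by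
  have h : ∀ᶠ p : Z × Z in 𝓝 (z, z), ∀ l ∈ L, l • p.1 ≠ p.2 :=
    hL.eventually_forall_of_forall_eventually fun l hl =>
      (isOpen_ne_fun (continuous_snd.smul (continuous_fst.comp continuous_fst))
        (continuous_snd.comp continuous_fst)).mem_nhds (hz l hl)
  rw [nhds_prod_eq] at h
  obtain ⟨O, hO, hOO⟩ := mem_prod_self_iff.1 h
  exact ⟨interior O, isOpen_interior, mem_interior_iff_mem_nhds.2 hO, fun l hl x hx hlx =>
    hOO (mk_mem_prod (interior_subset hx) (interior_subset hlx)) l hl rfl⟩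

/-- A maximal open subset of `E` moved off itself by `L`. -/
theorem exists_maximal_isOpen_forall_smul_notMem [IsTopologicalGroup G] {L : Set G}
    (hL : IsCompact L) {E : Set Z} (hE : IsOpen E) (hEL : ∀ z ∈ E, ∀ l ∈ L, l • z ≠ z) :
    ∃ D : Set Z, IsOpen D ∧ D ⊆ E ∧ (∀ l ∈ L, ∀ x ∈ D, l • x ∉ D) ∧
      E ⊆ (L ∪ L⁻¹ ∪ {1}) • closure D := by
  obtain ⟨D, hD⟩ := zorn_subset {D : Set Z | IsOpen D ∧ D ⊆ E ∧ ∀ l ∈ L, ∀ x ∈ D, l • x ∉ D} (by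
    intro c hc hch
    refine ⟨⋃₀ c, ⟨isOpen_sUnion fun D hD => (hc hD).1, sUnion_subset fun D hD => (hc hD).2.1, ?_⟩,
      fun D hD => subset_sUnion_of_mem hD⟩
    rintro l hl x ⟨D, hD, hx⟩ ⟨D', hD', hx'⟩
    rcases hch.total hD hD' with h | h
    · exact (hc hD').2.2 l hl x (h hx) hx'
    · exact (hc hD).2.2 l hl x hx (h hx'))
  obtain ⟨hDo, hDE, hDL⟩ := hD.prop
  refine ⟨D, hDo, hDE, hDL, fun z hz => ?_⟩
  by_contra hzT
  have hT : IsClosed ((L ∪ L⁻¹ ∪ {1}) • closure D) :=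
    isClosed_closure.smul_left_of_isCompact ((hL.union hL.inv).union isCompact_singleton)
  -- An uncovered `z` would allow a small piece around it to be added to `D`: `L` moves the piece
  -- off itself, and avoiding the translates of closure D rules out interaction with `D`.
  obtain ⟨O, hO, hzO, hOL⟩ := exists_isOpen_forall_smul_notMem hL (hEL z hz)
  have hmax : D ∪ (O ∩ E ∩ ((L ∪ L⁻¹ ∪ {1}) • closure D)ᶜ) ⊆ D := by
    refine hD.le_of_ge ⟨hDo.union ((hO.inter hE).inter hT.isOpen_compl),
      union_subset hDE (inter_subset_left.trans inter_subset_right), ?_⟩ subset_union_left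
    rintro l hl x (hx | hx) (hx' | hx')
    · exact hDL l hl x hx hx'
    · exact hx'.2 (smul_mem_smul (Or.inl (Or.inl hl)) (subset_closure hx))
    · refine hx.2 ?_
      rw [← inv_smul_smul l x]
      exact smul_mem_smul (Or.inl (Or.inr (inv_mem_inv.2 hl))) (subset_closure hx')
    · exact hOL l hl x hx.1.1 hx'.1.1
  refine hzT ?_
  rw [← one_smul G z]
  exact smul_mem_smul (Or.inr rfl) (subset_closure (hmax (Or.inr ⟨⟨hzO, hz⟩, hzT⟩)))

/-- A point fixed by `g` is not a limit of points moved by every element of a neighbourhood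
of `g`. -/
theorem IsMaximallyHighlyProximal.notMem_closure [IsTopologicalGroup G] [LocallyCompactSpace G]
    (hZ : IsMaximallyHighlyProximal G Z) {g : G} {z₀ : Z} (hg : g • z₀ = z₀) {L : Set G}
    (hLg : L ∈ 𝓝 g) (hL : IsCompact L) : z₀ ∉ closure {z : Z | ∀ l ∈ L, l • z ≠ z} := by
  intro hz₀
  have hc : Continuous fun v : G => v⁻¹ * g * v := by fun_prop
  have hm : (fun v : G => v⁻¹ * g * v) ⁻¹' interior L ∈ 𝓝 (1 : G) :=
    (isOpen_interior.preimage hc).mem_nhds (by simpa using mem_interior_iff_mem_nhds.2 hLg)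
  obtain ⟨V, hV, hVL, hVc⟩ := local_compact_nhds hm
  obtain ⟨W, hW, hWV⟩ : ∃ W ∈ 𝓝 (1 : G), ∀ a ∈ W, ∀ b ∈ W, a⁻¹ * b ∈ interior V := by
    have hc : Continuous fun p : G × G => p.1⁻¹ * p.2 := by fun_prop
    have hm : (fun p : G × G => p.1⁻¹ * p.2) ⁻¹' interior V ∈ 𝓝 ((1 : G), (1 : G)) :=
      (isOpen_interior.preimage hc).mem_nhds (by simpa using mem_interior_iff_mem_nhds.2 hV)
    rw [nhds_prod_eq] at hm
    obtain ⟨W, hW, hWW⟩ := mem_prod_self_iff.1 hm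
    exact ⟨W, hW, fun a ha b hb => hWW (mk_mem_prod ha hb)⟩
  obtain ⟨t, -, ht⟩ := ((hL.union hL.inv).union (isCompact_singleton (x := (1 : G)))).elim_nhds_subcover
    (fun l => l • W) (fun l _ => by simpa using smul_mem_nhds_smul l hW)
  choose D hDo hDE hDL hED using fun E : {E : Set Z // IsOpen E ∧ ∀ z ∈ E, ∀ l ∈ L, l • z ≠ z} =>
    exists_maximal_isOpen_forall_smul_notMem hL E.2.1 E.2.2
  -- Greedy exhaustion: each stage removes from `E n` the closure of `V • D (E n)`. Since `z₀` never
  -- lies in a removed set, points of the initial set near `z₀` survive any given number of stages.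
  let E : ℕ → {E : Set Z // IsOpen E ∧ ∀ z ∈ E, ∀ l ∈ L, l • z ≠ z} := fun n =>
    Nat.rec ⟨{z : Z | ∀ l ∈ L, l • z ≠ z}, isOpen_setOf_forall_smul_ne hL, fun _ h => h⟩
      (fun _ E => ⟨E.1 \ closure (V • D E), E.2.1.sdiff isClosed_closure,
        fun z hz => E.2.2 z hz.1⟩) n
  have hE0 : (E 0).1 = {z : Z | ∀ l ∈ L, l • z ≠ z} := rfl
  have hES : ∀ n, (E (n + 1)).1 = (E n).1 \ closure (V • D (E n)) := fun _ => rfl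
  clear_value E
  have hanti : Antitone fun n => (E n).1 :=
    antitone_nat_of_succ_le fun n => (hES n).le.trans sdiff_subset
  have hz₀D : ∀ n, z₀ ∉ closure (V • D (E n)) := by
    intro n hn
    obtain ⟨v, hv, d, hd, hvd⟩ := mem_smul.1 (closure_smul_subset_of_isCompact hVc _ hn)
    -- A conjugate of `g` lying in the interior of `L` fixes `d` in the closure of `D (E n)`; a
    -- perturbation of it inside `L` then returns a point of `D (E n)` to that set, contrary to its
    -- choice.
    have hfix : (v⁻¹ * g * v) • d = d := by
      rw [mul_smul, mul_smul, hvd, hg, ← hvd, inv_smul_smul]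
    obtain ⟨l, hl, x, hx, hlx⟩ := hZ.exists_smul_mem (hDo (E n)) (hDo (E n)) hd (hfix.symm ▸ hd)
      (mem_interior_iff_mem_nhds.1 (hVL hv))
    exact hDL (E n) l hl x hx hlx
  have hev : ∀ᶠ z in 𝓝 z₀, ∀ i : Fin (t.card + 1), z ∉ closure (V • D (E i)) :=
    eventually_all.2 fun i => isClosed_closure.isOpen_compl.mem_nhds (hz₀D i)
  obtain ⟨z, hzA, hzD⟩ := ((mem_closure_iff_frequently.1 hz₀).and_eventually hev).exists
  have hzE : ∀ n ≤ t.card, z ∈ (E n).1 := by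
    intro n
    induction n with
    | zero => exact fun _ => hE0.superset hzA
    | succ n ih =>
      intro hn
      rw [hES]
      exact ⟨ih (by omega), hzD ⟨n, by omega⟩⟩
  have hex : ∀ i : Fin (t.card + 1), ∃ l ∈ (L ∪ L⁻¹ ∪ {1}), ∃ d ∈ closure (D (E i)), l • d = z :=
    fun i => mem_smul.1 (hED (E i) (hzE i (by omega)))
  choose l hl d hd hld using hex
  have hcov : ∀ i, ∃ x : t, l i ∈ (x : G) • W := fun i => by
    obtain ⟨x, hx, hlx⟩ := mem_iUnion₂.1 (ht (hl i))
    exact ⟨⟨x, hx⟩, hlx⟩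
  choose f hf using hcov
  -- There are `t.card + 1` stages and `t.card` translates of `W`, so two of the `l i` share a
  -- translate and differ by an element of the interior of `V`. This element links the closures of
  -- two stages, although the earlier one removed its `V`-translates.
  obtain ⟨i, j, hne, hij⟩ := Fintype.exists_ne_map_eq_of_card_lt f (by simp)
  wlog hlt : i < j generalizing i j
  · exact this j i hne.symm hij.symm (lt_of_le_of_ne (not_lt.1 hlt) hne.symm)
  have hV' : (l j)⁻¹ * l i ∈ interior V := by
    obtain ⟨a, ha, hla⟩ := mem_smul_set.1 (hf i)
    obtain ⟨b, hb, hlb⟩ := mem_smul_set.1 (hf j)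
    rw [← hla, ← hlb, hij]
    simpa [smul_eq_mul, mul_assoc] using hWV b hb a ha
  have hdj : ((l j)⁻¹ * l i) • d i = d j := by rw [mul_smul, hld i, ← hld j, inv_smul_smul]
  obtain ⟨v, hv, x, hx, hvx⟩ := hZ.exists_smul_mem (hDo (E i)) (hDo (E j)) (hd i)
    (hdj.symm ▸ hd j) (mem_interior_iff_mem_nhds.1 hV')
  have h1 : v • x ∈ (E (i + 1)).1 := hanti (Nat.succ_le_of_lt hlt) (hDE (E j) hvx)
  rw [hES] at h1
  exact h1.2 (subset_closure (smul_mem_smul hv hx))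

theorem mem_stabMap {G : Type v} {Z : Type u} [Group G] [TopologicalSpace G] [TopologicalSpace Z]
    [T2Space Z] [MulAction G Z] [ContinuousSMul G Z] {g : G} {z : Z} :
    g ∈ (stabMap G Z z : Set G) ↔ g • z = z := Iff.rfl

/-- The stabilizer map of a maximally highly proximal flow of a locally compact group is
continuous. -/
theorem IsMaximallyHighlyProximal.continuous_stabMap {G : Type v} {Z : Type u} [Group G]
    [TopologicalSpace G] [IsTopologicalGroup G] [LocallyCompactSpace G] [TopologicalSpace Z]
    [T2Space Z] [MulAction G Z] [ContinuousSMul G Z] (hZ : IsMaximallyHighlyProximal G Z) :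
    Continuous (stabMap G Z) := by
  refine continuous_generateFrom_iff.2 ?_
  rintro _ (⟨K, hK, rfl⟩ | ⟨U, hU, rfl⟩)
  · convert isOpen_setOf_forall_smul_ne (Z := Z) hK using 1
    ext z
    exact ⟨fun h l hl hlz => h.subset ⟨hlz, hl⟩,
      fun h => subset_empty_iff.1 fun l hl => h l hl.2 hl.1⟩
  · rw [isOpen_iff_mem_nhds]
    rintro z ⟨g, hg, hgU⟩
    obtain ⟨L, hL, hLU, hLc⟩ := local_compact_nhds (hU.mem_nhds hgU)
    have := hZ.notMem_closure (mem_stabMap.1 hg) hL hLc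
    filter_upwards [isClosed_closure.isOpen_compl.mem_nhds this] with y hy
    have hy' : y ∉ {z : Z | ∀ l ∈ L, l • z ≠ z} := fun h => hy (subset_closure h)
    simp only [mem_ofPred_eq, not_forall, not_not] at hy'
    obtain ⟨l, hl, hly⟩ := hy'
    exact ⟨l, hly, hLU hl⟩

end

/-! ### The conjugation action on closed subgroups -/

section Conjugation

variable {G : Type v} [Group G] [TopologicalSpace G] [IsTopologicalGroup G]

theorem mem_conjClosedSubgroup {g x : G} {H : ClosedSubgroup G} :
    x ∈ (conjClosedSubgroup g H : Set G) ↔ g⁻¹ * x * g ∈ (H : Set G) := by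
  constructor
  · rintro ⟨y, hy, rfl⟩
    have hy' : y ∈ H := hy
    simpa [mul_assoc] using hy'
  · intro hx
    exact ⟨g⁻¹ * x * g, hx, by simp [mul_assoc]⟩

/-- The conjugation action on closed subgroups. -/
instance : MulAction G (ClosedSubgroup G) where
  smul := conjClosedSubgroup
  one_smul H := SetLike.coe_injective (by
    ext x
    show x ∈ (conjClosedSubgroup 1 H : Set G) ↔ _
    rw [mem_conjClosedSubgroup]
    simp)
  mul_smul a b H := SetLike.coe_injective (by
    ext x
    show x ∈ (conjClosedSubgroup (a * b) H : Set G) ↔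
      x ∈ (conjClosedSubgroup a (conjClosedSubgroup b H) : Set G)
    rw [mem_conjClosedSubgroup, mem_conjClosedSubgroup, mem_conjClosedSubgroup]
    simp only [mul_inv_rev, mul_assoc])

theorem ClosedSubgroup.mem_smul {g x : G} {H : ClosedSubgroup G} :
    x ∈ ((g • H : ClosedSubgroup G) : Set G) ↔ g⁻¹ * x * g ∈ (H : Set G) :=
  mem_conjClosedSubgroup

instance : ContinuousConstSMul G (ClosedSubgroup G) where
  continuous_const_smul g := by
    refine continuous_generateFrom_iff.2 ?_
    rintro _ (⟨K, hK, rfl⟩ | ⟨U, hU, rfl⟩)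
    · refine TopologicalSpace.isOpen_generateFrom_of_mem (Or.inl ⟨(fun x => g⁻¹ * x * g) '' K,
        hK.image (by fun_prop), ?_⟩)
      ext H
      simp only [mem_preimage, mem_ofPred_eq, ← disjoint_iff_inter_eq_empty, Set.disjoint_right,
        ClosedSubgroup.mem_smul, forall_mem_image]
    · refine TopologicalSpace.isOpen_generateFrom_of_mem (Or.inr ⟨(fun x => g * x * g⁻¹) ⁻¹' U,
        hU.preimage (by fun_prop), ?_⟩)
      ext H
      constructor
      · rintro ⟨x, hx, hxU⟩
        exact ⟨g⁻¹ * x * g, ClosedSubgroup.mem_smul.1 hx, by simpa [mul_assoc] using hxU⟩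
      · rintro ⟨x, hx, hxU⟩
        exact ⟨g * x * g⁻¹, ClosedSubgroup.mem_smul.2 (by simpa [mul_assoc] using hx), hxU⟩

theorem stabMap_smul {Z : Type u} [TopologicalSpace Z] [T2Space Z] [MulAction G Z]
    [ContinuousSMul G Z] (g : G) (z : Z) : stabMap G Z (g • z) = g • stabMap G Z z :=
  SetLike.coe_injective (by
    ext x
    rw [ClosedSubgroup.mem_smul, mem_stabMap, mem_stabMap, mul_smul, mul_smul, inv_smul_eq_iff])

end Conjugation

/-! ### Stabilizers upstairs versus limits of stabilizers downstairs -/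

/-- Generically, a point of an irreducible extension moved by all of `L` lies over a point moved by
all of `L`. -/
theorem IsIrreducibleMap.dense_forall_smul_ne {G Z X : Type*} [Group G] [TopologicalSpace G]
    [TopologicalSpace Z] [T2Space Z] [MulAction G Z] [ContinuousSMul G Z] [TopologicalSpace X]
    [MulAction G X] {π : Z → X} (h : IsIrreducibleMap π)
    (hG : ∀ (g : G) z, π (g • z) = g • π z) {L : Set G}
    (hL : IsCompact L) :
    Dense ({z : Z | ∀ l ∈ L, l • π z ≠ π z} ∪ (closure {z : Z | ∀ l ∈ L, l • z ≠ z})ᶜ) := by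
  rw [dense_iff_inter_open]
  rintro O hO ⟨y, hy⟩
  by_cases hcl : y ∈ closure {z : Z | ∀ l ∈ L, l • z ≠ z}
  · obtain ⟨y', hy'O, hy'⟩ := mem_closure_iff.1 hcl O hO hy
    -- A fibre contained in `B` is moved off itself by every element of `L`, so its base point is
    -- moved as well.
    obtain ⟨B, hB, hyB, hBL⟩ := exists_isOpen_forall_smul_notMem hL hy'
    obtain ⟨x, hx⟩ := h.exists_fiber_subset (B ∩ O) (hB.inter hO) ⟨y', hyB, hy'O⟩
    obtain ⟨w, rfl⟩ := h.surjective x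
    exact ⟨w, (hx rfl).2, Or.inl fun l hl hlw => hBL l hl w (hx rfl).1 (hx ((hG l w).trans hlw)).1⟩
  · exact ⟨y, hy, Or.inr hcl⟩

theorem isSubflow_closure_range_stabMap {G : Type v} {X : Type u} [Group G] [TopologicalSpace G]
    [IsTopologicalGroup G] [TopologicalSpace X] [T2Space X] [MulAction G X] [ContinuousSMul G X]
    [Nonempty X] :
    IsSubflow (closure (range (stabMap G X))) where
  nonempty := (range_nonempty _).closure
  isClosed := isClosed_closure
  conj_mem g H hH := by
    have hm : MapsTo (fun H : ClosedSubgroup G => g • H) (range (stabMap G X))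
        (range (stabMap G X)) := by
      rintro _ ⟨z, rfl⟩
      exact ⟨g • z, stabMap_smul g z⟩
    exact hm.closure (continuous_const_smul g) hH

theorem le_stabMap_of_mem_closure {G : Type v} {Z X : Type u} [Group G] [TopologicalSpace G]
    [TopologicalSpace Z] [TopologicalSpace X] [T2Space X] [MulAction G X] [ContinuousSMul G X]
    {π : Z → X} (hπ : Continuous π) {p : Z × ClosedSubgroup G}
    (hp : p ∈ closure (range fun z : Z => (z, stabMap G X (π z)))) :
    (p.2 : Set G) ⊆ stabMap G X (π p.1) := by
  intro g hg
  by_contra hgne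
  have hO : IsOpen {q : Z × G | q.2 • π q.1 ≠ π q.1} :=
    isOpen_ne_fun (continuous_snd.smul (hπ.comp continuous_fst)) (hπ.comp continuous_fst)
  have : {q : Z × G | q.2 • π q.1 ≠ π q.1} ∈ 𝓝 (p.1, g) := hO.mem_nhds hgne
  obtain ⟨O, U, hO, hpO, hU, hgU, hOU⟩ := mem_nhds_prod_iff'.1 this
  obtain ⟨_, ⟨hz, g', hg', hgU'⟩, z, rfl⟩ := mem_closure_iff.1 hp
    (O ×ˢ {H : ClosedSubgroup G | ((H : Set G) ∩ U).Nonempty})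
    (hO.prod (TopologicalSpace.isOpen_generateFrom_of_mem (Or.inr ⟨U, hU, rfl⟩))) ⟨hpO, g, hg, hgU⟩
  exact hOU (mk_mem_prod hz hgU') hg'

section

variable {G : Type v} [Group G] [TopologicalSpace G] {Z X : Type u} [TopologicalSpace Z]
  [TopologicalSpace X] [T2Space Z] [T2Space X] [MulAction G Z] [MulAction G X] [ContinuousSMul G Z]
  [ContinuousSMul G X] {π : Z → X}

/-- Each stabilizer upstairs lies in the one downstairs, and continuity of `stabMap G Z` carries the
inclusion to limits. -/
theorem stabMap_le_of_mem_closure [LocallyCompactSpace G] (hs : Continuous (stabMap G Z))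
    (hG : ∀ (g : G) z, π (g • z) = g • π z) {p : Z × ClosedSubgroup G}
    (hp : p ∈ closure (range fun z : Z => (z, stabMap G X (π z)))) :
    (stabMap G Z p.1 : Set G) ⊆ p.2 := by
  intro g hg
  by_contra hgp
  have hgp' : (p.2 : Set G)ᶜ ∈ 𝓝 g := p.2.isClosed'.isOpen_compl.mem_nhds hgp
  obtain ⟨K, hK, hKp, hKc⟩ := local_compact_nhds hgp'
  have hU : IsOpen {H : ClosedSubgroup G | ((H : Set G) ∩ interior K).Nonempty} :=
    TopologicalSpace.isOpen_generateFrom_of_mem (Or.inr ⟨_, isOpen_interior, rfl⟩)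
  have hV : IsOpen {H : ClosedSubgroup G | (H : Set G) ∩ K = ∅} :=
    TopologicalSpace.isOpen_generateFrom_of_mem (Or.inl ⟨_, hKc, rfl⟩)
  obtain ⟨_, ⟨⟨g', hg', hgK⟩, h2⟩, z, rfl⟩ := mem_closure_iff.1 hp _ ((hU.preimage hs).prod hV)
    ⟨⟨g, hg, mem_interior_iff_mem_nhds.2 hK⟩, subset_empty_iff.1 fun x hx => hKp hx.2 hx.1⟩
  refine h2.subset ⟨?_, interior_subset hgK⟩
  show g' • π z = π z
  rw [← hG, mem_stabMap.1 hg']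

variable [IsTopologicalGroup G] [LocallyCompactSpace G] [CompactSpace Z]

/-- A minimal flow of limits of stabilizers of `X` over `Z` consists of subgroups of stabilizers
of points of `Z`. -/
theorem IsIrreducibleMap.le_stabMap_of_isMinimal [MulAction.IsMinimal G Z]
    (h : IsIrreducibleMap π) (hG : ∀ (g : G) z, π (g • z) = g • π z)
    {M : SubMulAction G (Z × ClosedSubgroup G)} (hMcl : IsClosed (M : Set (Z × ClosedSubgroup G)))
    [MulAction.IsMinimal G M]
    (hM : (M : Set (Z × ClosedSubgroup G)) ⊆ closure (range fun z : Z => (z, stabMap G X (π z))))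
    (m : M) : (m.1.2 : Set G) ⊆ stabMap G Z m.1.1 := by
  intro g hg
  by_contra hgz
  have hne : {l : G | l • m.1.1 ≠ m.1.1} ∈ 𝓝 g :=
    (isOpen_ne_fun (continuous_id.smul continuous_const) continuous_const).mem_nhds hgz
  obtain ⟨L, hL, hLz, hLc⟩ := local_compact_nhds hne
  have hA : IsOpen {z : Z | ∀ l ∈ L, l • z ≠ z} := isOpen_setOf_forall_smul_ne hLc
  have hH : IsOpen {H : ClosedSubgroup G | ((H : Set G) ∩ interior L).Nonempty} :=
    TopologicalSpace.isOpen_generateFrom_of_mem (Or.inr ⟨_, isOpen_interior, rfl⟩)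
  have : CompactSpace M := isCompact_iff_compactSpace.1 hMcl.isCompact
  have : Nonempty M := ⟨m⟩
  have : Nonempty Z := ⟨m.1.1⟩
  have hq : Continuous fun m : M => m.1.1 := continuous_fst.comp continuous_subtype_val
  have : ContinuousConstSMul G M :=
    ⟨fun a => ((continuous_const_smul a).comp continuous_subtype_val).subtype_mk _⟩
  -- The pairs whose point is moved by all of `L` and whose subgroup meets the interior of `L` form
  -- an open set, so by minimality it has a translate through a generic fibre. There the base point
  -- is moved by all of `L`, yet fixed by some element of it.
  obtain ⟨I, hI⟩ := isCompact_univ.exists_finite_cover_smul G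
    ((hA.prod hH).preimage (continuous_subtype_val (p := fun p => p ∈ M)))
    ⟨m, fun l hl => hLz hl, g, hg, mem_interior_iff_mem_nhds.2 hL⟩
  obtain ⟨z, hz⟩ := (isOpen_and_dense_forall_inv_smul_mem (((isOpen_setOf_forall_smul_ne hLc).preimage
    h.continuous).union isClosed_closure.isOpen_compl) (h.dense_forall_smul_ne hG hLc) I).2.nonempty
  obtain ⟨m', rfl⟩ := surjective_of_isMinimal (G := G) hq (fun _ _ => rfl) z
  obtain ⟨a, ha, hm'⟩ := mem_iUnion₂.1 (hI (mem_univ m'))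
  rw [mem_smul_set_iff_inv_smul_mem] at hm'
  obtain ⟨hmA, l, hl, hlL⟩ := hm'
  rcases hz a ha with hza | hza
  · exact hza l (interior_subset hlL) (le_stabMap_of_mem_closure h.continuous (hM (a⁻¹ • m').2) hl)
  · exact hza (subset_closure hmA)

/-- The stabilizers of a universal irreducible extension lie in every flow of limits of
stabilizers of `X`. -/
theorem IsUniversalIrreducibleExtension.range_stabMap_subset [CompactSpace X] [Nonempty X]
    [MulAction.IsMinimal G X] (h : IsUniversalIrreducibleExtension G π)
    {N : Set (ClosedSubgroup G)} (hN : IsSubflow N) (hNX : N ⊆ closure (range (stabMap G X))) :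
    range (stabMap G Z) ⊆ N := by
  have hirr := h.toIsIrreducibleExtension.isIrreducibleMap
  have : MulAction.IsMinimal G Z := hirr.isMinimal h.map_smul
  have : Nonempty Z := hirr.surjective.nonempty
  have hs : Continuous (stabMap G Z) := h.isMaximallyHighlyProximal.continuous_stabMap
  obtain ⟨H, hH⟩ := hN.nonempty
  have hHW : H ∈ Prod.snd '' closure (range fun z : Z => (z, stabMap G X (π z))) := by
    refine closure_minimal ?_ (isClosed_closure.isCompact.image continuous_snd).isClosed (hNX hH)
    rintro _ ⟨x, rfl⟩
    obtain ⟨z, rfl⟩ := hirr.surjective x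
    exact ⟨_, subset_closure ⟨z, rfl⟩, rfl⟩
  obtain ⟨p, hp, rfl⟩ := hHW
  obtain ⟨M, hMW, hMcl, ⟨m, hm⟩, hMmin⟩ := exists_isMinimal_subMulAction (G := G)
    ((isClosed_closure (s := range fun z : Z => (z, stabMap G X (π z)))).inter
      (hN.isClosed.preimage continuous_snd)) ⟨p, hp, hH⟩ (fun g p hp => by
      have hm : MapsTo (fun p : Z × ClosedSubgroup G => g • p)
          (range fun z : Z => (z, stabMap G X (π z)))
          (range fun z : Z => (z, stabMap G X (π z))) := by
        rintro _ ⟨z, rfl⟩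
        refine ⟨g • z, Prod.ext rfl ?_⟩
        show stabMap G X (π (g • z)) = g • stabMap G X (π z)
        rw [h.map_smul, stabMap_smul]
      exact ⟨hm.closure (continuous_const_smul g) hp.1, hN.conj_mem g _ hp.2⟩)
  have : CompactSpace M := isCompact_iff_compactSpace.1 hMcl.isCompact
  have : Nonempty M := ⟨⟨m, hm⟩⟩
  rintro _ ⟨z, rfl⟩
  obtain ⟨m', rfl⟩ := surjective_of_isMinimal (G := G) (q := fun m : M => m.1.1)
    (continuous_fst.comp continuous_subtype_val) (fun _ _ => rfl) z
  have heq : stabMap G Z m'.1.1 = m'.1.2 := SetLike.coe_injective <|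
    (stabMap_le_of_mem_closure hs h.map_smul (hMW m'.2).1).antisymm
      (hirr.le_stabMap_of_isMinimal h.map_smul hMcl (hMW.trans inter_subset_left) m')
  rw [heq]
  exact (hMW m'.2).2

theorem isSubflow_range_stabMap [Nonempty Z] (hs : Continuous (stabMap G Z)) :
    IsSubflow (range (stabMap G Z)) where
  nonempty := range_nonempty _
  isClosed := (isCompact_range hs).isClosed
  conj_mem := by
    rintro g _ ⟨z, rfl⟩
    exact ⟨g • z, stabMap_smul g z⟩

end

/-- For a minimal flow `X` of a locally compact group `G`, the universal irreducible extension
exists, and the set of stabilizers of its points is the stabilizer URS of `X`. -/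
theorem corollary5p5 (G : Type v) [Group G] [TopologicalSpace G] [IsTopologicalGroup G]
    [LocallyCompactSpace G] (X : Type u) [TopologicalSpace X] [CompactSpace X] [T2Space X]
    [Nonempty X] [MulAction G X] [ContinuousSMul G X] [MulAction.IsMinimal G X] :
    (∃ (Z : Type u) (_ : TopologicalSpace Z) (_ : CompactSpace Z) (_ : T2Space Z)
      (_ : MulAction G Z) (_ : ContinuousSMul G Z) (π : Z → X),
        IsUniversalIrreducibleExtension G π) ∧
    ∀ (Z : Type u) [TopologicalSpace Z] [CompactSpace Z] [T2Space Z] [MulAction G Z]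
      [ContinuousSMul G Z] (π : Z → X), IsUniversalIrreducibleExtension G π →
        IsStabilizerURS G X (Set.range (stabMap G Z)) := by
  refine ⟨exists_isUniversalIrreducibleExtension G X, fun Z _ _ _ _ _ π h => ?_⟩
  have hirr := h.toIsIrreducibleExtension.isIrreducibleMap
  have : MulAction.IsMinimal G Z := hirr.isMinimal h.map_smul
  have : Nonempty Z := hirr.surjective.nonempty
  have hsub := isSubflow_range_stabMap h.isMaximallyHighlyProximal.continuous_stabMap
  have hX : range (stabMap G Z) ⊆ closure (range (stabMap G X)) :=
    h.range_stabMap_subset isSubflow_closure_range_stabMap subset_rfl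
  exact ⟨⟨hsub, fun N hN hNZ => h.range_stabMap_subset hN (hNZ.trans hX)⟩, hX, fun N hN hNX =>
    (hN.2 hsub (h.range_stabMap_subset hN.1 hNX)).antisymm (h.range_stabMap_subset hN.1 hNX)⟩
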